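/- Let $R$ be a commutative local noetherian profinite ring, let $G$ be a finite group, and let $M_1,\dots,M_s$ be pairwise non-isomorphic finitely generated indecomposable left $RG$-modules, each carrying its canonical topology (the quotient topology from a finite power of $RG$, which makes it a profinite $RG$-module). Put $M=\bigoplus_{i=1}^s M_i$. Let $\mathrm{add}(M)$ be the category of all finite direct sums of direct summands of $M$, regarded with their canonical topologies. Let $\varprojlim\mathrm{add}(M)$ be the category of all inverse limits, as topological $RG$-modules, of inverse systems of objects of $\mathrm{add}(M)$ indexed by directed posets, and let $\mathrm{Add}(M)$ be the category of all topological $RG$-modules isomorphic (algebraically and topologically) to one of the form $$\bigoplus_{i=1}^{s}\ \prod_{\kappa_i} M_i ,$$ where each $\kappa_i$ is a cardinal number and products carry the product topology. In both cases the morphisms are the continuous $RG$-module homomorphisms. Then every object of $\varprojlim\mathrm{add}(M)$ is isomorphic, as a topological $RG$-module, to $\bigoplus_{i=1}^{s}\prod_{\kappa_i} M_i$ for suitable cardinals $\kappa_i$. Moreover $\mathrm{Add}(M)$ is a full subcategory of $\varprojlim\mathrm{add}(M)$, and the inclusion $\mathrm{Add}(M)\to\varprojlim\mathrm{add}(M)$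 is an equivalence of categories. -/

import Mathlib

open CategoryTheory

universe u v w

/-- The topology on the group algebra `RG`: the topology of pointwise convergence of coefficients.
For finite `G` it is the product topology on `RG = R ^ G`. -/
instance MonoidAlgebra.topologicalSpaceCoeff (R : Type u) (G : Type v) [Semiring R]
    [TopologicalSpace R] : TopologicalSpace (MonoidAlgebra R G) :=
  TopologicalSpace.induced (fun x (g : G) => x.coeff g) inferInstance

theorem MonoidAlgebra.continuous_coeff_apply (R : Type u) (G : Type v) [Semiring R]
    [TopologicalSpace R] (g : G) : Continuous fun x : MonoidAlgebra R G => x.coeff g :=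
  (continuous_apply g).comp continuous_induced_dom

instance MonoidAlgebra.isTopologicalRing (R : Type u) (G : Type v) [Ring R]
    [TopologicalSpace R] [IsTopologicalRing R] [Group G] [Finite G] :
    IsTopologicalRing (MonoidAlgebra R G) where
  continuous_add := by
    refine continuous_induced_rng.2 (continuous_pi fun g => ?_)
    simpa using! ((continuous_coeff_apply R G g).comp continuous_fst).add
      ((continuous_coeff_apply R G g).comp continuous_snd)
  continuous_neg := by
    refine continuous_induced_rng.2 (continuous_pi fun g => ?_)
    exact (continuous_coeff_apply R G g).neg
  continuous_mul := by
    classical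
    have := Fintype.ofFinite G
    refine continuous_induced_rng.2 (continuous_pi fun g => ?_)
    have h : ∀ p : MonoidAlgebra R G × MonoidAlgebra R G,
        (p.1 * p.2).coeff g = ∑ a : G, p.1.coeff a * p.2.coeff (a⁻¹ * g) := by
      intro p
      rw [MonoidAlgebra.coeff_mul_apply_left, Finsupp.sum_fintype _ _ (by simp)]
    simp only [Function.comp_def, h]
    exact continuous_finsetSum _ fun a _ =>
      ((continuous_coeff_apply R G a).comp continuous_fst).mul
        ((continuous_coeff_apply R G _).comp continuous_snd)

section

variable {A : Type u} [Ring A] [TopologicalSpace A] {s : ℕ} (M : Fin s → Type w)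
  [∀ i, AddCommGroup (M i)] [∀ i, Module A (M i)]

/-- The objects of `add(M)` for `M = M₁ ⊕ ⋯ ⊕ Mₛ`, inside the category of topological `A`-modules
and continuous homomorphisms: the finite direct sums of direct summands of `M`, with their canonical
topology (the module topology). The finite direct sum of the `M i` is written as the
finite product `∀ i, M i`. -/
def smallAdd : ObjectProperty (TopModuleCat.{w} A) := fun X =>
  IsModuleTopology A X ∧
    ∃ (n : ℕ) (N : Fin n → Submodule A (∀ i, M i)),
      (∀ j, IsComplemented (N j)) ∧ Nonempty (X ≃ₗ[A] (∀ j, N j))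

/-- The objects of `lim add(M)`: the limits, in the category of topological `A`-modules, of inverse
systems of objects of `add(M)` indexed by directed posets. -/
def limAdd : ObjectProperty (TopModuleCat.{w} A) := fun U =>
  ∃ (I : Type w) (_ : PartialOrder I) (_ : IsDirectedOrder I) (_ : Nonempty I),
    (smallAdd M).limitsOfShape Iᵒᵖ U

/-- The objects of `Add(M)`: the topological modules that are isomorphic, algebraically and
topologically, to a direct sum over `i` of cartesian products of copies of `M i`. -/
def bigAdd [∀ i, TopologicalSpace (M i)] : ObjectProperty (TopModuleCat.{w} A) := fun U =>
  ∃ κ : Fin s → Type w, Nonempty (U ≃L[A] (∀ i, κ i → M i))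

end

open Topology Limits Opposite

/-! ### Finitely generated modules over compact rings -/

namespace IsModuleTopology

section

variable (A : Type*) [Ring A] [TopologicalSpace A] [IsTopologicalRing A] [CompactSpace A]
  (M : Type*) [AddCommGroup M] [Module A M] [TopologicalSpace M] [IsModuleTopology A M]
  [Module.Finite A M]

include A in
theorem compactSpace : CompactSpace M := by
  obtain ⟨n, f, hf⟩ := Module.Finite.exists_fin' A M
  have := toContinuousAdd A M
  exact hf.compactSpace (continuous_of_linearMap f)

variable {M} in
theorem isCompact_submodule [IsNoetherianRing A] (N : Submodule A M) : IsCompact (N : Set M) := by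
  obtain ⟨n, f, hf⟩ := Module.Finite.exists_fin' A N
  have := toContinuousAdd A M
  have h := isCompact_range (continuous_of_linearMap (N.subtype ∘ₗ f))
  rwa [LinearMap.coe_comp, Set.range_comp, hf.range_eq, Set.image_univ, Submodule.coe_subtype,
    Subtype.range_coe] at h

include A in
theorem t2Space [IsNoetherianRing A] [T2Space A] : T2Space M := by
  obtain ⟨n, f, hf⟩ := Module.Finite.exists_fin' A M
  have := topologicalAddGroup A M
  refine IsTopologicalAddGroup.t2Space_iff_zero_closed.2 ?_
  -- The preimage of `0` in `A ^ n` is a finitely generated kernel, hence compact.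
  rw [← (isQuotientMap_of_surjective hf).isClosed_preimage]
  exact (isCompact_submodule A (LinearMap.ker f)).isClosed

variable {M} in
theorem isClosed_submodule [IsNoetherianRing A] [T2Space A] (N : Submodule A M) :
    IsClosed (N : Set M) :=
  have := t2Space A M
  (isCompact_submodule A N).isClosed

end

end IsModuleTopology

/-! ### Adic filtrations and Nakayama's lemma -/

/-- A decreasing sequence of open submodules of `M` that is a basis of neighbourhoods of `0` and
whose first term satisfies the conclusion of Nakayama's lemma. -/
structure IsNakayamaFiltration {A M : Type*} [Ring A] [AddCommGroup M] [Module A M]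
    [TopologicalSpace M] (V : ℕ → Submodule A M) : Prop where
  antitone : Antitone V
  isOpen (n : ℕ) : IsOpen (V n : Set M)
  exists_subset {s : Set M} (hs : s ∈ 𝓝 0) : ∃ n, (V n : Set M) ⊆ s
  eq_top (N : Submodule A M) (h : N ⊔ V 0 = ⊤) : N = ⊤

/-- The submodule `I ^ n M` of an `A`-module `M`, for an ideal `I` of the base ring of `A`. -/
def Submodule.powSMulTop {R : Type*} (A M : Type*) [CommRing R] [Ring A] [Algebra R A]
    [AddCommGroup M] [Module A M] [Module R M] [IsScalarTower R A M] (I : Ideal R) (n : ℕ) :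
    Submodule A M :=
  { (I ^ n • ⊤ : Submodule R M) with
    smul_mem' := fun a x hx => by
      have := IsScalarTower.to_smulCommClass (R := R) (A := A) (M := M)
      have h : Submodule.map (DistribSMul.toLinearMap R M a) (I ^ n • ⊤) ≤ I ^ n • ⊤ := by
        rw [Submodule.map_smul'']
        exact Submodule.smul_mono le_rfl le_top
      exact h ⟨x, hx, rfl⟩ }

theorem exists_isNakayamaFiltration (R : Type*) [CommRing R] [TopologicalSpace R]
    [IsTopologicalRing R] [CompactSpace R] [T2Space R] [IsLocalRing R] [IsNoetherianRing R]
    (A : Type*) [Ring A] [Algebra R A] [Module.Finite R A] [TopologicalSpace A]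
    [IsTopologicalRing A] [CompactSpace A] [T2Space A]
    (M : Type*) [AddCommGroup M] [Module A M] [Module.Finite A M] [TopologicalSpace M]
    [IsModuleTopology A M] :
    ∃ V : ℕ → Submodule A M, IsNakayamaFiltration V := by
  let : Module R M := Module.compHom M (algebraMap R A)
  have : IsScalarTower R A M := ⟨fun r a x => by
    rw [Algebra.smul_def, mul_smul]; rfl⟩
  have : Module.Finite R M := Module.Finite.trans A M
  have : IsNoetherianRing A :=
    isNoetherian_of_tower R (isNoetherian_of_isNoetherianRing_of_finite R A)
  have := IsModuleTopology.topologicalAddGroup A M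
  have := IsModuleTopology.t2Space A M
  have := IsModuleTopology.compactSpace A M
  have hfin : Finite (R ⧸ IsLocalRing.maximalIdeal R) :=
    inferInstanceAs (Finite (IsLocalRing.ResidueField R))
  let I := IsLocalRing.maximalIdeal R
  -- The exponent starts at 1 so that Nakayama's lemma applies to `V 0`.
  let V : ℕ → Submodule A M := fun n => Submodule.powSMulTop A M I (n + 1)
  have hcl : ∀ n, IsClosed (V n : Set M) := fun n => IsModuleTopology.isClosed_submodule A (V n)
  have hanti : Antitone V := fun m n hmn => by
    have : (I ^ (n + 1) • ⊤ : Submodule R M) ≤ I ^ (m + 1) • ⊤ :=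
      Submodule.smul_mono_left (Ideal.pow_le_pow_right (by lia))
    exact this
  refine ⟨V, hanti, fun n => ?_, fun {s} hs => ?_, fun N hN => ?_⟩
  -- The residue field is finite, so `V n` has finite index; being closed, it is open.
  · have hf : Finite (R ⧸ I ^ (n + 1)) :=
      Ideal.finite_quotient_pow (IsNoetherian.noetherian _) _
    have hf2 : Finite (M ⧸ (⊤ : Submodule R M)) := inferInstance
    have hf3 : Finite (M ⧸ (I ^ (n + 1) • ⊤ : Submodule R M)) :=
      Submodule.finite_quotient_smul _ Module.Finite.fg_top
    have : (V n).toAddSubgroup.FiniteIndex :=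
      @AddSubgroup.finiteIndex_of_finite_quotient _ _ _ hf3
    exact (V n).toAddSubgroup.isOpen_of_isClosed_of_finiteIndex (hcl n)
  -- By Krull's theorem the compact sets `V n` intersect in `0`, so one of them lies in `s`.
  · refine exists_subset_nhds_of_isCompact (V := fun n => (V n : Set M))
      (directed_of_isDirected_le fun _ _ h => hanti h) (fun n => (hcl n).isCompact) fun x hx => ?_
    have h0 := Ideal.iInf_pow_smul_eq_bot_of_isLocalRing (M := M) I
      (Ideal.IsPrime.ne_top inferInstance)
    have hx0 : x ∈ (⨅ i : ℕ, I ^ i • ⊤ : Submodule R M) := by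
      refine (Submodule.mem_iInf _).2 fun i => ?_
      have hx' : x ∈ (I ^ (i + 1) • ⊤ : Submodule R M) := Set.mem_iInter.1 hx i
      exact Submodule.smul_mono_left (Ideal.pow_le_pow_right (by lia)) hx'
    rw [h0] at hx0
    rw [(Submodule.mem_bot R).1 hx0]
    exact hs
  · have h : (⊤ : Submodule R M) ≤ N.restrictScalars R := by
      refine Submodule.le_of_le_smul_of_le_jacobson_bot (I := I) Module.Finite.fg_top
        (IsLocalRing.maximalIdeal_le_jacobson _) fun x _ => ?_
      have hx : x ∈ N ⊔ V 0 := hN ▸ Submodule.mem_top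
      obtain ⟨y, hy, z, hz, rfl⟩ := Submodule.mem_sup.1 hx
      refine Submodule.add_mem_sup hy ?_
      have hz' : z ∈ (I ^ (0 + 1) • ⊤ : Submodule R M) := hz
      simpa using hz'
    exact eq_top_iff.2 fun x hx => h hx

/-- Scalars from `R` act as `A`-endomorphisms, so finite generation over the noetherian ring `R`
suffices. These generators feed the induction in `eq_bot_of_le_iSup_map_isNonsplit`. -/
theorem exists_finset_forall_eq_sum_end (R : Type*) [CommRing R] [IsNoetherianRing R]
    {A : Type*} [Ring A] [Algebra R A] [Module.Finite R A]
    {M : Type*} [AddCommGroup M] [Module A M] [Module.Finite A M] (Y : Submodule A M) :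
    ∃ F : Finset M, (∀ y ∈ F, y ∈ Y) ∧
      ∀ x ∈ Y, ∃ c : M → M →ₗ[A] M, x = ∑ y ∈ F, c y y := by
  let : Module R M := Module.compHom M (algebraMap R A)
  have : IsScalarTower R A M := ⟨fun r a x => by
    rw [Algebra.smul_def, mul_smul]; rfl⟩
  have := IsScalarTower.to_smulCommClass (R := R) (A := A) (M := M)
  have := IsScalarTower.to_smulCommClass' (R := R) (A := A) (M := M)
  have : Module.Finite R M := Module.Finite.trans A M
  obtain ⟨F, hF⟩ := IsNoetherian.noetherian (Y.restrictScalars R)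
  refine ⟨F, fun y hy => ?_, fun x hx => ?_⟩
  · have : y ∈ Y.restrictScalars R := hF ▸ Submodule.subset_span hy
    exact this
  · have hx' : x ∈ Submodule.span R (F : Set M) := hF ▸ hx
    obtain ⟨c, -, hc⟩ := Submodule.mem_span_finset.1 hx'
    exact ⟨fun y => c y • LinearMap.id, by simp [← hc]⟩

/-! ### Approximately linear maps and local endomorphism rings -/

section

variable {A : Type*} [Ring A] {M N : Type*} [AddCommGroup M] [Module A M] [AddCommGroup N]
  [Module A N]

/-- A function between modules that is linear modulo a submodule of the codomain. -/
def IsLinearMod (V : Submodule A N) (f : M → N) : Prop :=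
  ∀ (a : A) (x y : M), f (a • x + y) - a • f x - f y ∈ V

namespace IsLinearMod

variable {V W : Submodule A N} {f : M → N}

theorem mono (h : V ≤ W) (hf : IsLinearMod V f) : IsLinearMod W f := fun a x y => h (hf a x y)

theorem comp_linearMap {P : Type*} [AddCommGroup P] [Module A P] (hf : IsLinearMod V f)
    (e : P →ₗ[A] M) : IsLinearMod V fun x => f (e x) := fun a x y => by
  simpa using hf a (e x) (e y)

theorem sub_linearMap (hf : IsLinearMod V f) (g : M →ₗ[A] N) :
    IsLinearMod V fun x => f x - g x := fun a x y => by
  convert hf a x y using 1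
  simp only [map_add, map_smul, smul_sub]
  abel

theorem map_zero_mem (hf : IsLinearMod V f) : f 0 ∈ V := by
  simpa using hf 1 0 0

theorem map_add_sub_mem (hf : IsLinearMod V f) (x y : M) : f (x + y) - (f x + f y) ∈ V := by
  simpa [sub_sub] using hf 1 x y

theorem map_sum_sub_mem (hf : IsLinearMod V f) {ι : Type*} (s : Finset ι) (x : ι → M) :
    f (∑ i ∈ s, x i) - ∑ i ∈ s, f (x i) ∈ V := by
  classical
  induction s using Finset.induction_on with
  | empty => simpa using hf.map_zero_mem
  | insert i s hi ih =>
    rw [Finset.sum_insert hi, Finset.sum_insert hi]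
    convert V.add_mem (hf.map_add_sub_mem (x i) (∑ i ∈ s, x i)) ih using 1
    abel

theorem mem_of_span_eq_top (hf : IsLinearMod V f) {F : Set M} (hF : Submodule.span A F = ⊤)
    (h : ∀ x ∈ F, f x ∈ V) (x : M) : f x ∈ V := by
  have hx : x ∈ Submodule.span A F := hF ▸ Submodule.mem_top
  induction hx using Submodule.span_induction with
  | mem x hx => exact h x hx
  | zero => exact hf.map_zero_mem
  | add x y _ _ hx hy =>
    simpa using V.add_mem (hf.map_add_sub_mem x y) (V.add_mem hx hy)
  | smul a x _ hx =>
    have := V.add_mem (hf a x 0) (V.add_mem (V.smul_mem a hx) hf.map_zero_mem)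
    simpa using this

theorem of_linearMap (V : Submodule A N) (g : M →ₗ[A] N) : IsLinearMod V g := fun a x y => by
  simp

end IsLinearMod

namespace IsNakayamaFiltration

variable [TopologicalSpace N] {V : ℕ → Submodule A N}

theorem eq_zero [T1Space N] (hV : IsNakayamaFiltration V) {x : N} (hx : ∀ n, x ∈ V n) :
    x = 0 := by
  by_contra h
  obtain ⟨n, hn⟩ := hV.exists_subset (compl_singleton_mem_nhds (Ne.symm h))
  exact hn (hx n) rfl

/-- The range of `g` together with `V 0` is everything, so `g` is surjective, and a surjective
endomorphism of a noetherian module is bijective. -/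
theorem isUnit_of_sub_mem [IsNoetherian A N] (hV : IsNakayamaFiltration V) {f g : Module.End A N}
    (hf : IsUnit f) (h : ∀ x, f x - g x ∈ V 0) : IsUnit g := by
  rw [Module.End.isUnit_iff] at hf ⊢
  refine IsNoetherian.bijective_of_surjective_endomorphism g (LinearMap.range_eq_top.1 ?_)
  refine hV.eq_top _ (eq_top_iff.2 fun y _ => ?_)
  obtain ⟨x, rfl⟩ := hf.2 y
  exact Submodule.mem_sup.2 ⟨g x, ⟨x, rfl⟩, f x - g x, h x, by abel⟩

variable [IsTopologicalAddGroup N]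

theorem isClosed (hV : IsNakayamaFiltration V) (n : ℕ) : IsClosed (V n : Set N) :=
  (V n).toAddSubgroup.isClosed_of_isOpen (hV.isOpen n)

theorem mem_of_forall_mem_sup (hV : IsNakayamaFiltration V) {Y : Submodule A N}
    (hY : IsClosed (Y : Set N)) {x : N} (hx : ∀ n, ∃ y ∈ Y, x - y ∈ V n) : x ∈ Y := by
  by_contra h
  have h0 : (fun z => x - z) ⁻¹' (Y : Set N)ᶜ ∈ 𝓝 (0 : N) :=
    (hY.isOpen_compl.preimage (by fun_prop)).mem_nhds (by simpa using h)
  obtain ⟨n, hn⟩ := hV.exists_subset h0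
  obtain ⟨y, hy, hxy⟩ := hx n
  exact hn hxy (by simpa using hy)

/-- The functions linear modulo `V n` form closed subsets of the compact space `M → N`, and their
intersection over `n` is the set of linear maps. Hence for large `n` they all lie in a given
neighbourhood of that set. -/
theorem exists_linearMap_sub_mem [CompactSpace N] [T2Space N] [ContinuousConstSMul A N]
    (hV : IsNakayamaFiltration V) (M : Type*) [AddCommGroup M] [Module A M] [Module.Finite A M]
    (L : ℕ) : ∃ n, ∀ f : M → N, IsLinearMod (V n) f → ∃ g : M →ₗ[A] N, ∀ x, f x - g x ∈ V L := by
  obtain ⟨F, hF⟩ := Module.Finite.fg_top (R := A) (M := M)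
  let C : ℕ → Set (M → N) := fun n => {f | IsLinearMod (V n) f}
  have hC : ∀ n, IsClosed (C n) := fun n => by
    simp only [C, IsLinearMod, Set.ofPred_forall]
    refine isClosed_iInter fun a => isClosed_iInter fun x => isClosed_iInter fun y => ?_
    exact (hV.isClosed n).preimage (by fun_prop)
  obtain ⟨n, hn⟩ := exists_subset_nhds_of_isCompact (V := C)
    (U := {f | ∃ g : M →ₗ[A] N, ∀ x ∈ F, f x - g x ∈ V L})
    (directed_of_isDirected_le fun _ _ h f hf => hf.mono (hV.antitone h))
    (fun n => (hC n).isCompact) fun f hf => by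
      have hf' : ∀ a x y, f (a • x + y) - a • f x - f y = 0 := fun a x y =>
        hV.eq_zero fun n => Set.mem_iInter.1 hf n a x y
      have h0 : f 0 = 0 := by simpa using hf' 1 0 0
      let g : M →ₗ[A] N :=
        { toFun := f
          map_add' := fun x y => by simpa [sub_sub, sub_eq_zero] using hf' 1 x y
          map_smul' := fun a x => by simpa [h0, sub_eq_zero] using hf' a x 0 }
      refine Filter.mem_of_superset (IsOpen.mem_nhds (s := {f : M → N | ∀ x ∈ F, f x - g x ∈ V L}) ?_ ?_)
        fun f hf => ⟨g, hf⟩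
      · simp only [Set.ofPred_forall]
        exact isOpen_biInter_finset fun x _ => (hV.isOpen L).preimage (by fun_prop)
      · intro x _
        simp [g]
  -- Closeness is known only on generators; linearity modulo `V L` extends it to all of `M`.
  refine ⟨max n L, fun f hf => ?_⟩
  obtain ⟨g, hg⟩ := hn (hf.mono (hV.antitone (le_max_left n L)))
  exact ⟨g, ((hf.mono (hV.antitone (le_max_right n L))).sub_linearMap g).mem_of_span_eq_top hF hg⟩

/-- If all idempotent endomorphisms of `N` are trivial, then its endomorphism ring is local. -/
theorem isUnit_or_isUnit_one_sub [TopologicalSpace A] [IsModuleTopology A N] [CompactSpace N]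
    [T2Space N] [IsNoetherian A N] (hV : IsNakayamaFiltration V)
    (hN : ∀ e : Module.End A N, e * e = e → e = 0 ∨ e = 1) (f : Module.End A N) :
    IsUnit f ∨ IsUnit (1 - f) := by
  let : TopologicalSpace (Module.End A N) := TopologicalSpace.induced (fun f => (f : N → N))
    inferInstance
  have hind : IsInducing (fun f : Module.End A N => (f : N → N)) := ⟨rfl⟩
  have hcl : IsClosedEmbedding (fun f : Module.End A N => (f : N → N)) :=
    ⟨⟨hind, DFunLike.coe_injective⟩, LinearMap.isClosed_range_coe N N (RingHom.id A)⟩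
  have : CompactSpace (Module.End A N) := hcl.compactSpace
  have : T2Space (Module.End A N) := hcl.isEmbedding.t2Space
  have hev (x : N) : Continuous fun g : Module.End A N => g x :=
    (continuous_apply x).comp hind.continuous
  have hr (r : Module.End A N) : Continuous (· * r) :=
    hind.continuous_iff.2 (continuous_pi fun x => hev (r x))
  have hl (r : Module.End A N) : Continuous (r * ·) :=
    hind.continuous_iff.2 (continuous_pi fun x =>
      (IsModuleTopology.continuous_of_linearMap r).comp (hev x))
  -- The closure of the positive powers of `f` is a compact semigroup, so it contains an idempotent.
  -- Some power of `f` is then close to `0` or to `1`; the zeroth power is excluded, as it would say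
  -- nothing about `f`.
  let S : Set (Module.End A N) := {g | ∃ n : ℕ, g = f ^ (n + 1)}
  have hS : ∀ x ∈ S, ∀ y ∈ S, x * y ∈ S := by
    rintro _ ⟨m, rfl⟩ _ ⟨n, rfl⟩
    exact ⟨m + n + 1, by rw [← pow_add]; congr 1; lia⟩
  have hS1 : ∀ x ∈ S, ∀ y ∈ closure S, x * y ∈ closure S := fun x hx y hy =>
    map_mem_closure (hl x) hy fun z hz => hS x hx z hz
  have hS2 : ∀ x ∈ closure S, ∀ y ∈ closure S, x * y ∈ closure S := fun x hx y hy =>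
    closure_closure (s := S) ▸ map_mem_closure (f := (· * y)) (hr y) hx fun z hz => hS1 z hz y hy
  obtain ⟨e, he, hee⟩ := exists_idempotent_in_compact_subsemigroup hr (closure S)
    (Set.Nonempty.closure ⟨f ^ (0 + 1), 0, rfl⟩) isClosed_closure.isCompact hS2
  obtain ⟨F, hF⟩ := IsNoetherian.noetherian (⊤ : Submodule A N)
  obtain ⟨_, hg, n, rfl⟩ := mem_closure_iff.1 he {g | ∀ x ∈ F, e x - g x ∈ V 0} (by
    simp only [Set.ofPred_forall]
    exact isOpen_biInter_finset fun x _ => (hV.isOpen 0).preimage (continuous_const.sub (hev x)))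
    fun x _ => by simp
  have hg' : ∀ x, e x - (f ^ (n + 1)) x ∈ V 0 :=
    ((IsLinearMod.of_linearMap (V 0) e).sub_linearMap (f ^ (n + 1))).mem_of_span_eq_top hF hg
  rcases hN e hee with rfl | rfl
  · right
    have h1 : IsUnit (1 - f ^ (n + 1)) := hV.isUnit_of_sub_mem isUnit_one fun x => by
      simpa using hg' x
    rw [← mul_neg_geom_sum, Commute.isUnit_mul_iff] at h1
    · exact h1.1
    · exact ((Commute.one_left _).sub_left (Commute.sum_right _ _ _ fun i _ => Commute.self_pow f i))
  · left
    exact (isUnit_pow_iff (Nat.succ_ne_zero n)).1 (hV.isUnit_of_sub_mem isUnit_one hg')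

end IsNakayamaFiltration

/-! ### Nonsplit homomorphisms -/

/-- A linear map that has no linear section. -/
def LinearMap.IsNonsplit (h : M →ₗ[A] N) : Prop :=
  ∀ f : N →ₗ[A] M, h ∘ₗ f ≠ LinearMap.id

namespace LinearMap.IsNonsplit

theorem comp {h : M →ₗ[A] N} (hh : h.IsNonsplit) {P : Type*} [AddCommGroup P] [Module A P]
    (g : P →ₗ[A] M) : (h ∘ₗ g).IsNonsplit := fun f => hh (g ∘ₗ f)

theorem not_isUnit {h : M →ₗ[A] N} (hh : h.IsNonsplit) (f : N →ₗ[A] M) :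
    ¬ IsUnit (h ∘ₗ f : Module.End A N) := fun ⟨u, hu⟩ =>
  hh (f ∘ₗ (↑u⁻¹ : Module.End A N)) (by
    rw [← LinearMap.comp_assoc, ← hu]
    exact u.mul_inv)

theorem zero [Nontrivial N] : (0 : M →ₗ[A] N).IsNonsplit := fun f hf => by
  obtain ⟨x, hx⟩ := exists_ne (0 : N)
  exact hx (by simpa using (LinearMap.congr_fun hf x).symm)

/-- If `f` were a section of `g + h`, then `g ∘ f` and `h ∘ f` would sum to `1`, so one of them
would be a unit by locality. -/
theorem add (hN : ∀ f : Module.End A N, IsUnit f ∨ IsUnit (1 - f)) {g h : M →ₗ[A] N}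
    (hg : g.IsNonsplit) (hh : h.IsNonsplit) : (g + h).IsNonsplit := fun f hf => by
  rcases hN (g ∘ₗ f) with h1 | h1
  · exact hg.not_isUnit f h1
  · refine hh.not_isUnit f ?_
    convert h1
    rw [eq_sub_iff_add_eq', ← LinearMap.add_comp]
    exact hf

end LinearMap.IsNonsplit

end

/-! ### Compactness in inverse limits -/

theorem exists_compatible_mem_of_isClosed {I : Type*} [Preorder I] [IsDirectedOrder I]
    {Y : I → Type*} [∀ i, TopologicalSpace (Y i)] [∀ i, CompactSpace (Y i)] [∀ i, T2Space (Y i)]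
    [∀ i, Nonempty (Y i)] (t : ∀ i j, i ≤ j → Y j → Y i) (ht : ∀ i j h, Continuous (t i j h))
    (t_self : ∀ i x, t i i le_rfl x = x)
    (t_trans : ∀ i j k hij hjk x, t i j hij (t j k hjk x) = t i k (hij.trans hjk) x)
    (k₀ : I) (S : ∀ i, Set (Y i)) (hS : ∀ i, k₀ ≤ i → IsClosed (S i))
    (hne : ∀ i, k₀ ≤ i → (S i).Nonempty)
    (hmap : ∀ i j hij, k₀ ≤ i → ∀ x ∈ S j, t i j hij x ∈ S i) :
    ∃ x : ∀ i, Y i, (∀ i j h, t i j h (x j) = x i) ∧ ∀ i, k₀ ≤ i → x i ∈ S i := by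
  classical
  let Z : {k // k₀ ≤ k} → Set (∀ i, Y i) := fun k =>
    {x | x k ∈ S k ∧ ∀ (i : I) (h : i ≤ k), t i k h (x k) = x i}
  have hZ : ∀ k, IsClosed (Z k) := fun k => by
    simp only [Z, Set.ofPred_and, Set.ofPred_forall]
    refine ((hS k k.2).preimage (continuous_apply _)).inter ?_
    exact isClosed_iInter fun i => isClosed_iInter fun h =>
      isClosed_eq ((ht i k h).comp (continuous_apply _)) (continuous_apply _)
  have hanti : ∀ k l : {k // k₀ ≤ k}, k ≤ l → Z l ⊆ Z k := fun k l h x hx => by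
    refine ⟨hx.2 k h ▸ hmap _ _ h k.2 _ hx.1, fun i hi => ?_⟩
    rw [← hx.2 k h, t_trans, hx.2]
  have hdir : Directed (· ⊇ ·) Z := fun k l => by
    obtain ⟨m, hkm, hlm⟩ := exists_ge_ge (k : I) l
    exact ⟨⟨m, k.2.trans hkm⟩, hanti _ _ hkm, hanti _ _ hlm⟩
  have : Nonempty {k // k₀ ≤ k} := ⟨⟨k₀, le_rfl⟩⟩
  obtain ⟨x, hx⟩ := IsCompact.nonempty_iInter_of_directed_nonempty_isCompact_isClosed Z hdir
    (fun k => by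
      obtain ⟨y, hy⟩ := hne k k.2
      -- Only the coordinates below `k` are constrained in `Z k`, so the others are arbitrary.
      let x : ∀ i, Y i := fun i => if h : i ≤ k then t i k h y else Classical.arbitrary _
      have hxk : x k = y := by simp [x, t_self]
      exact ⟨x, hxk ▸ hy, fun i h => by rw [hxk]; simp [x, h]⟩)
    (fun k => (hZ k).isCompact) hZ
  rw [Set.mem_iInter] at hx
  refine ⟨x, fun i j h => ?_, fun i hi => (hx ⟨i, hi⟩).1⟩
  obtain ⟨k, hjk, hk⟩ := exists_ge_ge j k₀
  rw [← (hx ⟨k, hk⟩).2 j hjk, t_trans, (hx ⟨k, hk⟩).2]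

section

variable {A : Type*} [Ring A] {I : Type*} [Preorder I] {X : I → Type*}
  [∀ i, AddCommGroup (X i)] [∀ i, Module A (X i)] [∀ i, TopologicalSpace (X i)]
  {U : Type*} [AddCommGroup U] [Module A U] [TopologicalSpace U]

/-- The topological module `U` is the limit, with projections `π`, of the inverse system of
topological modules `X` with transition maps `t`. -/
structure IsInverseLimit (t : ∀ i j, i ≤ j → X j →ₗ[A] X i) (π : ∀ i, U →ₗ[A] X i) : Prop where
  map_self (i : I) (x : X i) : t i i le_rfl x = x
  map_map (i j k : I) (hij : i ≤ j) (hjk : j ≤ k) (x : X k) :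
    t i j hij (t j k hjk x) = t i k (hij.trans hjk) x
  map_proj (i j : I) (h : i ≤ j) (u : U) : t i j h (π j u) = π i u
  isEmbedding : IsEmbedding fun (u : U) i => π i u
  exists_lift (x : ∀ i, X i) (hx : ∀ i j h, t i j h (x j) = x i) : ∃ u, ∀ i, π i u = x i

namespace IsInverseLimit

variable {t : ∀ i j, i ≤ j → X j →ₗ[A] X i} {π : ∀ i, U →ₗ[A] X i}

theorem ext (hU : IsInverseLimit t π) {u v : U} (h : ∀ i, π i u = π i v) : u = v :=
  hU.isEmbedding.injective (funext h)

theorem t2Space (hU : IsInverseLimit t π) [∀ i, T2Space (X i)] : T2Space U :=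
  hU.isEmbedding.t2Space

theorem compactSpace (hU : IsInverseLimit t π) [∀ i, T2Space (X i)] [∀ i, CompactSpace (X i)]
    (ht : ∀ i j h, Continuous (t i j h)) : CompactSpace U := by
  have hr : Set.range (fun (u : U) i => π i u) =
      {x | ∀ i j h, t i j h (x j) = x i} := by
    ext x
    constructor
    · rintro ⟨u, rfl⟩ i j h
      exact hU.map_proj i j h u
    · intro hx
      obtain ⟨u, hu⟩ := hU.exists_lift x hx
      exact ⟨u, funext hu⟩
  refine IsClosedEmbedding.compactSpace ⟨hU.isEmbedding, ?_⟩
  rw [hr]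
  simp only [Set.ofPred_forall]
  exact isClosed_iInter fun i => isClosed_iInter fun j => isClosed_iInter fun h =>
    isClosed_eq ((ht i j h).comp (continuous_apply _)) (continuous_apply _)

variable [IsDirectedOrder I]

theorem exists_preimage_subset [Nonempty I] (hU : IsInverseLimit t π)
    (ht : ∀ i j h, Continuous (t i j h)) {s : Set U} (hs : s ∈ 𝓝 0) :
    ∃ i, ∃ W ∈ 𝓝 (0 : X i), π i ⁻¹' W ⊆ s := by
  rw [hU.isEmbedding.nhds_eq_comap, nhds_pi, Filter.mem_comap] at hs
  obtain ⟨w, hw, hws⟩ := hs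
  obtain ⟨F, hF, W, hW, hFW⟩ := Filter.mem_pi.1 hw
  obtain ⟨k, hk⟩ := hF.toFinset.exists_le
  simp only [Set.Finite.mem_toFinset] at hk
  refine ⟨k, ⋂ i ∈ F, ⋂ h : i ≤ k, t i k h ⁻¹' W i, ?_, fun u hu => hws (hFW fun i hi => ?_)⟩
  · refine (Filter.biInter_mem hF).2 fun i hi => ?_
    simp only [hk i hi, Set.iInter_true]
    refine (ht i k (hk i hi)).continuousAt.preimage_mem_nhds ?_
    simpa using hW i
  · have := Set.mem_iInter.1 (Set.mem_iInter₂.1 hu i hi) (hk i hi)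
    rwa [Set.mem_preimage, hU.map_proj] at this

variable [∀ i, CompactSpace (X i)] [∀ i, T2Space (X i)]

/-- A Mittag-Leffler property: if every `X k` contained points whose images in `X i` avoid the range
of `π i` modulo `O`, compactness would give a compatible family of such points, which lifts to `U`,
a contradiction. -/
theorem exists_forall_exists_sub_mem (hU : IsInverseLimit t π) (ht : ∀ i j h, Continuous (t i j h))
    [∀ i, ContinuousSub (X i)] {i : I} {O : Submodule A (X i)} (hO : IsOpen (O : Set (X i))) :
    ∃ k, ∃ h : i ≤ k, ∀ x, ∃ u, π i u - t i k h x ∈ O := by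
  by_contra! H
  obtain ⟨x, hx, hxS⟩ := exists_compatible_mem_of_isClosed (fun i j h => t i j h) ht hU.map_self
    hU.map_map i (fun k => {x | ∀ h : i ≤ k, ∀ u, π i u - t i k h x ∉ O})
    (fun k hk => by
      simp only [Set.ofPred_forall]
      exact isClosed_iInter fun h => isClosed_iInter fun u => hO.isClosed_compl.preimage
        (continuous_const.sub (ht i k h)))
    (fun k hk => by
      obtain ⟨x, hx⟩ := H k hk
      exact ⟨x, fun _ => hx⟩)
    fun j k hjk hij x hx h u => by
      rw [hU.map_map]
      exact hx _ u
  obtain ⟨u, hu⟩ := hU.exists_lift x hx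
  refine hxS i le_rfl le_rfl u ?_
  rw [hu, hU.map_self, sub_self]
  exact O.zero_mem

variable {N : Type*} [AddCommGroup N] [Module A N] [TopologicalSpace N]

/-- If `g` split at every later stage, the sections would form an inverse system of nonempty compact
sets, and a compatible choice would assemble to a section of `g ∘ π k`. -/
theorem exists_isNonsplit_comp [T2Space N] (hU : IsInverseLimit t π) (ht : ∀ i j h, Continuous (t i j h))
    [∀ i, ContinuousAdd (X i)] [∀ i, ContinuousConstSMul A (X i)] {k : I} {g : X k →ₗ[A] N}
    (hg : Continuous g) (h : (g ∘ₗ π k).IsNonsplit) :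
    ∃ l, ∃ hkl : k ≤ l, (g ∘ₗ t k l hkl).IsNonsplit := by
  by_contra! H
  obtain ⟨x, hx, hxS⟩ := exists_compatible_mem_of_isClosed (Y := fun i => N → X i)
    (fun i j h f n => t i j h (f n))
    (fun i j h => continuous_pi fun n => (ht i j h).comp (continuous_apply n))
    (fun i f => funext fun n => hU.map_self i _)
    (fun i j l hij hjl f => funext fun n => hU.map_map i j l hij hjl _) k
    (fun l => {f | (∃ f' : N →ₗ[A] X l, (f' : N → X l) = f) ∧
      ∀ (hkl : k ≤ l) n, g (t k l hkl (f n)) = n})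
    (fun l _ => by
      simp only [Set.ofPred_and, Set.ofPred_forall]
      refine (LinearMap.isClosed_range_coe N (X l) (RingHom.id A)).inter ?_
      exact isClosed_iInter fun hkl => isClosed_iInter fun n =>
        isClosed_eq (hg.comp ((ht k l hkl).comp (continuous_apply n))) continuous_const)
    (fun l hkl => by
      have := H l hkl
      simp only [LinearMap.IsNonsplit, ne_eq, not_forall, not_not] at this
      obtain ⟨f, hf⟩ := this
      exact ⟨f, ⟨f, rfl⟩, fun _ n => LinearMap.congr_fun hf n⟩)
    fun i j hij hki f hf => by
      obtain ⟨⟨f, rfl⟩, hf⟩ := hf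
      refine ⟨⟨t i j hij ∘ₗ f, rfl⟩, fun hkl n => ?_⟩
      rw [hU.map_map]
      exact hf _ n
  have hlin : ∀ i, ∃ f : N →ₗ[A] X i, (f : N → X i) = x i := fun i => by
    obtain ⟨l, hil, hkl⟩ := exists_ge_ge i k
    obtain ⟨f, hf⟩ := (hxS l hkl).1
    exact ⟨t i l hil ∘ₗ f, by rw [← hx i l hil, ← hf]; rfl⟩
  choose f hf using hlin
  choose u hu using fun n => hU.exists_lift (fun i => x i n) fun i j h => congr_fun (hx i j h) n
  refine h { toFun := u
             map_add' := fun m n => hU.ext fun i => ?_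
             map_smul' := fun a n => hU.ext fun i => ?_ } ?_
  · simp only [map_add, hu, ← hf]
  · simp only [map_smul, hu, ← hf, RingHom.id_apply]
  · ext n
    have := (hxS k le_rfl).2 le_rfl n
    rw [hU.map_self] at this
    simpa [hu] using this

/-- A continuous homomorphism from an inverse limit is approximated by homomorphisms that factor
through one of the terms, as soon as approximately linear functions on the terms are approximated
by homomorphisms. -/
theorem exists_sub_comp_mem [Nonempty I] (hU : IsInverseLimit t π)
    (ht : ∀ i j h, Continuous (t i j h)) [∀ i, ContinuousSub (X i)]
    (hX : ∀ i, ∀ s ∈ 𝓝 (0 : X i), ∃ O : Submodule A (X i), IsOpen (O : Set (X i)) ∧ (O : Set _) ⊆ s)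
    {V : ℕ → Submodule A N} (hV : IsNakayamaFiltration V) {L n : ℕ}
    (hn : ∀ i, ∀ f : X i → N, IsLinearMod (V n) f → ∃ g : X i →ₗ[A] N, ∀ x, f x - g x ∈ V L)
    {h : U →ₗ[A] N} (hh : Continuous h) :
    ∃ k, ∃ g : X k →ₗ[A] N, ∀ u, h u - g (π k u) ∈ V L := by
  have hs : h ⁻¹' (V (max n L)) ∈ 𝓝 (0 : U) :=
    ((hV.isOpen _).preimage hh).mem_nhds (by simp)
  obtain ⟨i, W, hW, hWs⟩ := hU.exists_preimage_subset ht hs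
  obtain ⟨O, hO, hOW⟩ := hX i W hW
  have hO' : ∀ u, π i u ∈ O → h u ∈ V (max n L) := fun u hu => hWs (hOW hu)
  obtain ⟨k, hik, hk⟩ := hU.exists_forall_exists_sub_mem ht hO
  -- The choice of `u` need not be linear, but its defect maps into `O` under `π i`, so `h ∘ u` is
  -- linear modulo `V n`.
  choose u hu using hk
  obtain ⟨g, hg⟩ := hn k (fun x => h (u x)) (IsLinearMod.mono (hV.antitone (le_max_left n L))
    fun a x y => by
      rw [← map_smul, ← map_sub, ← map_sub]
      refine hO' _ ?_
      convert O.sub_mem (O.sub_mem (hu (a • x + y)) (O.smul_mem a (hu x))) (hu y) using 1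
      simp only [map_sub, map_smul, map_add, smul_sub]
      abel)
  refine ⟨k, g, fun v => ?_⟩
  have h1 : h (v - u (π k v)) ∈ V L := hV.antitone (le_max_right n L) <| hO' _ <| by
    rw [← neg_mem_iff]
    simpa [hU.map_proj] using hu (π k v)
  convert (V L).add_mem h1 (hg (π k v)) using 1
  rw [map_sub]
  abel

end IsInverseLimit

end

/-! ### Nakayama's lemma for the radical -/

section

variable {A : Type*} [Ring A] {ι : Type*} {M : ι → Type*} [∀ a, AddCommGroup (M a)]
  [∀ a, Module A (M a)]

/-- Nakayama's lemma for families of submodules of modules with local endomorphism rings that are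
generated by their images under nonsplit homomorphisms. -/
theorem eq_bot_of_le_iSup_map_isNonsplit [∀ a, Nontrivial (M a)]
    (hM : ∀ a, ∀ f : Module.End A (M a), IsUnit f ∨ IsUnit (1 - f)) {Y : ∀ a, Submodule A (M a)}
    (hY : ∀ a, Y a ≤ ⨆ b, ⨆ ρ : {ρ : M b →ₗ[A] M a // ρ.IsNonsplit}, (Y b).map ρ.1)
    (F : Finset (Σ a, M a)) (hF : ∀ p ∈ F, p.2 ∈ Y p.1)
    (hgen : ∀ a, ∀ x ∈ Y a, ∃ c : ∀ p : Σ a, M a, M p.1 →ₗ[A] M a, x = ∑ p ∈ F, c p p.2) (a : ι) :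
    Y a = ⊥ := by
  classical
  induction F using Finset.induction_on generalizing a with
  | empty =>
    refine (Submodule.eq_bot_iff _).2 fun x hx => ?_
    obtain ⟨c, hc⟩ := hgen a x hx
    simpa using hc
  | insert q F hq ih =>
    have key : q.2 ∈ ⨆ b, ⨆ ρ : {ρ : M b →ₗ[A] M q.1 // ρ.IsNonsplit}, (Y b).map ρ.1 :=
      hY q.1 (hF q (Finset.mem_insert_self _ _))
    have hsum : ∃ c : ∀ p : Σ a, M a, M p.1 →ₗ[A] M q.1, (∀ p, (c p).IsNonsplit) ∧
        q.2 = ∑ p ∈ insert q F, c p p.2 := by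
      refine Submodule.iSup_induction _ (motive := fun x =>
        ∃ c : ∀ p : Σ a, M a, M p.1 →ₗ[A] M q.1, (∀ p, (c p).IsNonsplit) ∧
          x = ∑ p ∈ insert q F, c p p.2) key (fun b x hx => ?_) ?_ ?_
      · refine Submodule.iSup_induction _ (motive := fun x =>
          ∃ c : ∀ p : Σ a, M a, M p.1 →ₗ[A] M q.1, (∀ p, (c p).IsNonsplit) ∧
            x = ∑ p ∈ insert q F, c p p.2) hx ?_ ?_ ?_
        · rintro ⟨ρ, hρ⟩ _ ⟨y, hy, rfl⟩
          obtain ⟨c, hc⟩ := hgen b y hy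
          exact ⟨fun p => ρ ∘ₗ c p, fun p => hρ.comp _, by rw [hc, map_sum]; rfl⟩
        · exact ⟨fun _ => 0, fun _ => LinearMap.IsNonsplit.zero, by simp⟩
        · rintro _ _ ⟨c, hc, rfl⟩ ⟨d, hd, rfl⟩
          exact ⟨fun p => c p + d p, fun p => (hc p).add (hM _) (hd p), by
            simp [Finset.sum_add_distrib]⟩
      · exact ⟨fun _ => 0, fun _ => LinearMap.IsNonsplit.zero, by simp⟩
      · rintro _ _ ⟨c, hc, rfl⟩ ⟨d, hd, rfl⟩
        exact ⟨fun p => c p + d p, fun p => (hc p).add (hM _) (hd p), by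
          simp [Finset.sum_add_distrib]⟩
    obtain ⟨c, hc, hqc⟩ := hsum
    rw [Finset.sum_insert hq] at hqc
    -- The coefficient of `q` in its own expansion is a nonunit, so `1 - c q` is invertible and the
    -- generator `q` is redundant.
    obtain ⟨u, hu⟩ := (hM q.1 (c q)).resolve_left fun h => (hc q).not_isUnit LinearMap.id h
    have hq2 : q.2 = ∑ p ∈ F, ((↑u⁻¹ : Module.End A (M q.1)) ∘ₗ c p) p.2 := by
      have h1 : (u : Module.End A (M q.1)) q.2 = ∑ p ∈ F, c p p.2 := by
        rw [hu, LinearMap.sub_apply, Module.End.one_apply, sub_eq_iff_eq_add']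
        exact hqc
      have h2 := congrArg (↑u⁻¹ : Module.End A (M q.1)) h1
      rw [← Module.End.mul_apply, Units.inv_mul, Module.End.one_apply, map_sum] at h2
      exact h2
    refine ih (fun p hp => hF p (Finset.mem_insert_of_mem hp)) (fun b x hx => ?_) a
    obtain ⟨d, hd⟩ := hgen b x hx
    refine ⟨fun p => d q ∘ₗ (↑u⁻¹ : Module.End A (M q.1)) ∘ₗ c p + d p, ?_⟩
    rw [hd, Finset.sum_insert hq]
    conv_lhs => rw [hq2]
    simp [Finset.sum_add_distrib]

end

/-! ### Maximal split families -/

section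

variable {A : Type*} [Ring A] {ι : Type*} {M : ι → Type*} [∀ a, AddCommGroup (M a)]
  [∀ a, Module A (M a)] [∀ a, TopologicalSpace (M a)]
  {U : Type*} [AddCommGroup U] [Module A U] [TopologicalSpace U]

/-- A finite family of continuous homomorphisms `U → M a` such that the induced homomorphism from
`U` to the product of the codomains has a section. -/
def IsSplitFamily (F : Finset (Σ a, U →L[A] M a)) : Prop :=
  ∃ s : ∀ p : Σ a, U →L[A] M a, M p.1 →ₗ[A] U, (∀ p ∈ F, ∀ x, p.2 (s p x) = x) ∧
    ∀ p ∈ F, ∀ q ∈ F, p ≠ q → ∀ x, p.2 (s q x) = 0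

theorem IsSplitFamily.mono {F F' : Finset (Σ a, U →L[A] M a)} (hF : IsSplitFamily F)
    (h : F' ⊆ F) : IsSplitFamily F' := by
  obtain ⟨s, h1, h2⟩ := hF
  exact ⟨s, fun p hp => h1 p (h hp), fun p hp q hq => h2 p (h hp) q (h hq)⟩

theorem isSplitFamily_empty : IsSplitFamily (∅ : Finset (Σ a, U →L[A] M a)) :=
  ⟨fun _ => 0, by simp, by simp⟩

-- Asking only for sections of finite subfamilies makes the condition one of finite character, so
-- Tukey's lemma applies.
variable (A M U) in
theorem exists_maximal_isSplitFamily :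
    ∃ S : Set (Σ a, U →L[A] M a), (∀ F : Finset (Σ a, U →L[A] M a), ↑F ⊆ S → IsSplitFamily F) ∧
      ∀ p ∉ S, ∃ F : Finset (Σ a, U →L[A] M a), ↑F ⊆ insert p S ∧ ¬ IsSplitFamily F := by
  let C : Set (Set (Σ a, U →L[A] M a)) :=
    {S | ∀ F : Finset (Σ a, U →L[A] M a), ↑F ⊆ S → IsSplitFamily F}
  have hC : Order.IsOfFiniteCharacter C := fun S =>
    ⟨fun h T hT _ F hF => h F (hF.trans hT),
      fun h F hF => h F hF F.finite_toSet F subset_rfl⟩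
  obtain ⟨S, -, hS⟩ := hC.exists_maximal (x := ∅) fun F hF => by
    rw [Set.subset_empty_iff, Finset.coe_eq_empty] at hF
    exact hF ▸ isSplitFamily_empty
  refine ⟨S, hS.1, fun p hp => ?_⟩
  by_contra! H
  exact hp (hS.2 (y := insert p S) H (Set.subset_insert _ _) (Set.mem_insert _ _))

variable [TopologicalSpace A] [∀ a, IsModuleTopology A (M a)]

/-- A homomorphism that does not extend a split family is congruent to a nonsplit homomorphism
modulo the span of the family. -/
theorem IsSplitFamily.exists_isNonsplit {F : Finset (Σ a, U →L[A] M a)} (hF : IsSplitFamily F)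
    {a : ι} {h : U →L[A] M a} (hh : (⟨a, h⟩ : Σ a, U →L[A] M a) ∉ F) [DecidableEq (Σ a, U →L[A] M a)]
    (hins : ¬ IsSplitFamily (insert ⟨a, h⟩ F)) :
    ∃ g : U →ₗ[A] M a, Continuous g ∧ g.IsNonsplit ∧
      ∀ u, (∀ p ∈ F, p.2 u = 0) → h u = g u := by
  obtain ⟨s, h1, h2⟩ := hF
  have hca : ContinuousAdd (M a) := IsModuleTopology.toContinuousAdd A (M a)
  have : IsTopologicalAddGroup (M a) := IsModuleTopology.topologicalAddGroup A (M a)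
  let g : U →ₗ[A] M a := (h : U →ₗ[A] M a) - ∑ p ∈ F, (h : U →ₗ[A] M a) ∘ₗ s p ∘ₗ (p.2 : U →ₗ[A] M p.1)
  have hg (u : U) : g u = h u - ∑ p ∈ F, h (s p (p.2 u)) := by simp [g]
  refine ⟨g, ?_, fun f hf => hins ?_, fun u hu => ?_⟩
  · have : (g : U → M a) = fun u => h u - ∑ p ∈ F, h (s p (p.2 u)) := funext hg
    rw [this]
    exact h.continuous.sub (continuous_finsetSum _ fun p _ =>
      -- `s p` is merely linear, but `h ∘ s p` is a linear map between modules with the module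
      -- topology.
      (IsModuleTopology.continuous_of_linearMap ((h : U →ₗ[A] M a) ∘ₗ s p)).comp p.2.continuous)
  -- Correcting `f` makes it vanish under `F` while remaining a section, now of `h`; the old
  -- sections are then corrected to vanish under `h`.
  · let f' : M a →ₗ[A] U := f - ∑ p ∈ F, s p ∘ₗ (p.2 : U →ₗ[A] M p.1) ∘ₗ f
    have hf' (x : M a) : f' x = f x - ∑ p ∈ F, s p (p.2 (f x)) := by simp [f']
    have hhf (x : M a) : h (f' x) = x := by
      rw [hf', map_sub, map_sum, ← hg]
      exact LinearMap.congr_fun hf x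
    have hpf (p) (hp : p ∈ F) (x : M a) : p.2 (f' x) = 0 := by
      rw [hf', map_sub, map_sum, Finset.sum_eq_single p, h1 p hp, sub_self]
      · exact fun q hq hqp => h2 p hp q hq hqp.symm _
      · exact fun h => absurd hp h
    let s' : ∀ p : Σ a, U →L[A] M a, M p.1 →ₗ[A] U :=
      Function.update (fun p => s p - f' ∘ₗ (h : U →ₗ[A] M a) ∘ₗ s p) ⟨a, h⟩ f'
    have hs1 : s' ⟨a, h⟩ = f' := Function.update_self ..
    have hs2 (p) (hp : p ∈ F) (x) : s' p x = s p x - f' (h (s p x)) := by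
      have : p ≠ ⟨a, h⟩ := fun e => hh (e ▸ hp)
      simp [s', Function.update_of_ne this]
    refine ⟨s', fun p hp x => ?_, fun p hp q hq hpq x => ?_⟩
    · rcases Finset.mem_insert.1 hp with rfl | hp
      · rw [hs1]
        exact hhf x
      · rw [hs2 p hp, map_sub, h1 p hp, hpf p hp, sub_zero]
    · rcases Finset.mem_insert.1 hp with rfl | hp
      · have hq := (Finset.mem_insert.1 hq).resolve_left hpq.symm
        rw [hs2 q hq, map_sub]
        change h _ - h _ = 0
        rw [hhf, sub_self]
      · rcases Finset.mem_insert.1 hq with rfl | hq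
        · rw [hs1]
          exact hpf p hp x
        · rw [hs2 q hq, map_sub, h2 p hp q hq hpq, hpf p hp, sub_zero]
  · rw [hg, Finset.sum_eq_zero fun p hp => by rw [hu p hp, map_zero, map_zero], sub_zero]

end

/-! ### The decomposition theorem -/

/-- `X` is a retract of a finite direct sum of members of the family `M`. -/
def IsRetractOfSum (A : Type*) [Ring A] {ι : Type*} (M : ι → Type*) [∀ a, AddCommGroup (M a)]
    [∀ a, Module A (M a)] (X : Type*) [AddCommGroup X] [Module A X] : Prop :=
  ∃ (n : ℕ) (b : Fin n → ι) (p : ∀ i, X →ₗ[A] M (b i)) (e : ∀ i, M (b i) →ₗ[A] X),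
    ∀ x, ∑ i, e i (p i x) = x

theorem IsRetractOfSum.exists_sub_mem {A : Type*} [Ring A] {ι : Type*} {M : ι → Type*}
    [∀ a, AddCommGroup (M a)] [∀ a, Module A (M a)] {X : Type*} [AddCommGroup X] [Module A X]
    (hX : IsRetractOfSum A M X) {N : Type*} [AddCommGroup N] [Module A N] {V W : Submodule A N}
    (hVW : V ≤ W)
    (h : ∀ b, ∀ f : M b → N, IsLinearMod V f → ∃ g : M b →ₗ[A] N, ∀ x, f x - g x ∈ W)
    {f : X → N} (hf : IsLinearMod V f) : ∃ g : X →ₗ[A] N, ∀ x, f x - g x ∈ W := by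
  obtain ⟨n, b, p, e, hpe⟩ := hX
  choose g hg using fun i => h (b i) (fun x => f (e i x)) (hf.comp_linearMap (e i))
  refine ⟨∑ i, g i ∘ₗ p i, fun x => ?_⟩
  have h1 := hVW (hf.map_sum_sub_mem Finset.univ fun i => e i (p i x))
  rw [hpe] at h1
  have h2 := W.sum_mem fun i (_ : i ∈ Finset.univ) => hg i (p i x)
  rw [Finset.sum_sub_distrib] at h2
  convert W.add_mem h1 h2 using 1
  simp

theorem exists_continuousLinearEquiv_pi_of_isInverseLimit
    (R : Type*) [CommRing R] [TopologicalSpace R] [IsTopologicalRing R] [CompactSpace R] [T2Space R]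
    [IsLocalRing R] [IsNoetherianRing R]
    {A : Type*} [Ring A] [Algebra R A] [Module.Finite R A] [TopologicalSpace A]
    [IsTopologicalRing A] [CompactSpace A] [T2Space A]
    {ι : Type*} [Finite ι] {M : ι → Type*} [∀ a, AddCommGroup (M a)]
    [∀ a, Module A (M a)] [∀ a, TopologicalSpace (M a)] [∀ a, IsModuleTopology A (M a)]
    [∀ a, Module.Finite A (M a)] [∀ a, Nontrivial (M a)]
    (hM : ∀ a, ∀ e : Module.End A (M a), e * e = e → e = 0 ∨ e = 1)
    {I : Type*} [Preorder I] [IsDirectedOrder I] [Nonempty I] {X : I → Type*}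
    [∀ i, AddCommGroup (X i)] [∀ i, Module A (X i)] [∀ i, TopologicalSpace (X i)]
    [∀ i, IsModuleTopology A (X i)] [∀ i, Module.Finite A (X i)]
    (hX : ∀ i, IsRetractOfSum A M (X i))
    {U : Type w} [AddCommGroup U] [Module A U] [TopologicalSpace U]
    {t : ∀ i j, i ≤ j → X j →ₗ[A] X i} {π : ∀ i, U →ₗ[A] X i} (hU : IsInverseLimit t π)
    (hπ : ∀ i, Continuous (π i)) :
    ∃ S : Set (Σ a, U →L[A] M a),
      Nonempty (U ≃L[A] ∀ a, {h : U →L[A] M a // (⟨a, h⟩ : Σ a, U →L[A] M a) ∈ S} → M a) := by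
  classical
  cases nonempty_fintype ι
  have : IsNoetherianRing A :=
    isNoetherian_of_tower R (isNoetherian_of_isNoetherianRing_of_finite R A)
  have (a : ι) := IsModuleTopology.topologicalAddGroup A (M a)
  have (a : ι) := IsModuleTopology.t2Space A (M a)
  have (a : ι) := IsModuleTopology.compactSpace A (M a)
  have (i : I) := IsModuleTopology.topologicalAddGroup A (X i)
  have (i : I) := IsModuleTopology.t2Space A (X i)
  have (i : I) := IsModuleTopology.compactSpace A (X i)
  have ht (i j h) : Continuous (t i j h) := IsModuleTopology.continuous_of_linearMap _
  have := hU.t2Space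
  have := hU.compactSpace ht
  choose V hV using fun a => exists_isNakayamaFiltration R A (M a)
  have hloc (a : ι) := (hV a).isUnit_or_isUnit_one_sub (hM a)
  have hXO (i : I) (s : Set (X i)) (hs : s ∈ 𝓝 0) :
      ∃ O : Submodule A (X i), IsOpen (O : Set (X i)) ∧ (O : Set _) ⊆ s := by
    obtain ⟨W, hW⟩ := exists_isNakayamaFiltration R A (X i)
    obtain ⟨n, hn⟩ := hW.exists_subset hs
    exact ⟨W n, hW.isOpen n, hn⟩
  have hlift (a : ι) (L : ℕ) : ∃ n, ∀ i, ∀ f : X i → M a, IsLinearMod (V a n) f →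
      ∃ g : X i →ₗ[A] M a, ∀ x, f x - g x ∈ V a L := by
    choose n hn using fun b => (hV a).exists_linearMap_sub_mem (M b) L
    -- There are finitely many `M b`, so one bound serves all `X i`.
    refine ⟨max (Finset.univ.sup n) L, fun i f hf => (hX i).exists_sub_mem
      ((hV a).antitone (le_max_right _ L)) (fun b f hf => hn b f (hf.mono ((hV a).antitone
        ((Finset.le_sup (Finset.mem_univ b)).trans (le_max_left _ L))))) hf⟩
  obtain ⟨S, hS, hmax⟩ := exists_maximal_isSplitFamily A M U
  have hred (a : ι) (h : U →L[A] M a) : ∃ g : U →ₗ[A] M a, Continuous g ∧ g.IsNonsplit ∧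
      ∀ u, (∀ p ∈ S, p.2 u = 0) → h u = g u := by
    by_cases hhS : (⟨a, h⟩ : Σ a, U →L[A] M a) ∈ S
    · exact ⟨0, continuous_const, LinearMap.IsNonsplit.zero, fun u hu => hu _ hhS⟩
    · obtain ⟨F, hFS, hF⟩ := hmax _ hhS
      have hsub : ↑(F.erase ⟨a, h⟩) ⊆ S := fun p hp => by
        rw [Finset.mem_coe, Finset.mem_erase] at hp
        exact (hFS hp.2).resolve_left hp.1
      obtain ⟨g, hg, hgn, hgu⟩ := (hS _ hsub).exists_isNonsplit (h := h) (Finset.notMem_erase _ _)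
        fun hins => hF (hins.mono (Finset.insert_erase_subset _ _))
      exact ⟨g, hg, hgn, fun u hu => hgu u fun p hp => hu p (hsub hp)⟩
  let Y : ∀ a, Submodule A (M a) := fun a =>
    Submodule.span A {x | ∃ h : U →L[A] M a, ∃ u, (∀ p ∈ S, p.2 u = 0) ∧ h u = x}
  have hYmem {a : ι} (h : U →L[A] M a) {u : U} (hu : ∀ p ∈ S, p.2 u = 0) : h u ∈ Y a :=
    Submodule.subset_span ⟨h, u, hu, rfl⟩
  have hY (a : ι) :
      Y a ≤ ⨆ b, ⨆ ρ : {ρ : M b →ₗ[A] M a // ρ.IsNonsplit}, (Y b).map ρ.1 := by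
    refine Submodule.span_le.2 ?_
    rintro _ ⟨h, u, hu, rfl⟩
    obtain ⟨g, hg, hgn, hgu⟩ := hred a h
    rw [hgu u hu]
    -- The right-hand side is closed, so membership may be checked modulo each `V a L`.
    refine (hV a).mem_of_forall_mem_sup (IsModuleTopology.isClosed_submodule A _) fun L => ?_
    obtain ⟨n, hn⟩ := hlift a L
    obtain ⟨k, q, hq⟩ := hU.exists_sub_comp_mem ht hXO (hV a) hn hg
    -- A section `f` of `q ∘ π k` would make `g ∘ f` congruent to `1` modulo `V a 0`, hence a unit.
    have hqn : (q ∘ₗ π k).IsNonsplit := fun f hf => by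
      refine hgn.not_isUnit f ((hV a).isUnit_of_sub_mem (f := 1) isUnit_one fun x => ?_)
      rw [← neg_mem_iff, neg_sub]
      have h1 := (hV a).antitone (Nat.zero_le L) (hq (f x))
      have h2 : q (π k (f x)) = x := LinearMap.congr_fun hf x
      rwa [h2] at h1
    obtain ⟨l, hkl, hl⟩ := hU.exists_isNonsplit_comp ht
      (IsModuleTopology.continuous_of_linearMap q) hqn
    refine ⟨q (π k u), ?_, hq u⟩
    obtain ⟨m, b, p, e, hpe⟩ := hX l
    rw [← hU.map_proj k l hkl u, ← hpe (π l u), map_sum, map_sum]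
    refine Submodule.sum_mem _ fun i _ => Submodule.mem_iSup_of_mem (b i)
      (Submodule.mem_iSup_of_mem ⟨q ∘ₗ t k l hkl ∘ₗ e i, hl.comp (e i)⟩ ?_)
    exact ⟨p i (π l u), hYmem ⟨p i ∘ₗ π l,
      (IsModuleTopology.continuous_of_linearMap (p i)).comp (hπ l)⟩ hu, rfl⟩
  choose G hGY hG using fun a => exists_finset_forall_eq_sum_end R (Y a)
  have hY0 := eq_bot_of_le_iSup_map_isNonsplit hloc hY (Finset.univ.sigma G)
    (fun p hp => hGY p.1 p.2 (Finset.mem_sigma.1 hp).2) fun a x hx => by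
      obtain ⟨c, hc⟩ := hG a x hx
      -- Generators belonging to the other modules get coefficient zero.
      let d : ∀ p : Σ a, M a, M p.1 →ₗ[A] M a := fun p =>
        if h : p.1 = a then h ▸ c (h ▸ p.2) else 0
      refine ⟨d, ?_⟩
      rw [Finset.sum_sigma, Finset.sum_eq_single a, hc]
      · simp [d]
      · intro b _ hb
        simp [d, hb]
      · simp
  have hinj (u : U) (hu : ∀ p ∈ S, p.2 u = 0) : u = 0 := hU.ext fun l => by
    obtain ⟨m, b, p, e, hpe⟩ := hX l
    rw [← hpe (π l u), map_zero]
    refine Finset.sum_eq_zero fun i _ => ?_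
    have : p i (π l u) ∈ Y (b i) := hYmem ⟨p i ∘ₗ π l,
      (IsModuleTopology.continuous_of_linearMap (p i)).comp (hπ l)⟩ hu
    rw [hY0, Submodule.mem_bot] at this
    rw [this, map_zero]
  have hsurj (y : ∀ p : Σ a, U →L[A] M a, M p.1) : ∃ u, ∀ p ∈ S, p.2 u = y p := by
    obtain ⟨u, -, hu⟩ := isCompact_univ.inter_iInter_nonempty
      (fun p : S => {u : U | p.1.2 u = y p}) (fun p => isClosed_eq p.1.2.continuous
        continuous_const) fun F => by
        obtain ⟨s, h1, h2⟩ := hS (F.map (Function.Embedding.subtype _)) (by simp)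
        refine ⟨∑ q ∈ F, s q (y q), trivial, Set.mem_iInter₂.2 fun p hp => ?_⟩
        change p.1.2 _ = _
        rw [map_sum, Finset.sum_eq_single p]
        · exact h1 p (by simp [hp]) _
        · exact fun q hq hqp => h2 p (by simp [hp]) q (by simp [hq])
            (fun e => hqp (Subtype.ext e.symm)) _
        · exact fun h => absurd hp h
    exact ⟨u, fun p hp => Set.mem_iInter.1 hu ⟨p, hp⟩⟩
  let φ : U →L[A] ∀ a, {h : U →L[A] M a // (⟨a, h⟩ : Σ a, U →L[A] M a) ∈ S} → M a :=
    ContinuousLinearMap.pi fun a => ContinuousLinearMap.pi fun h => h.1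
  have hφ : Function.Bijective φ := by
    refine ⟨(injective_iff_map_eq_zero φ).2 fun u hu => hinj u fun p hp => ?_, fun y => ?_⟩
    · exact congr_fun (congr_fun hu p.1) ⟨p.2, hp⟩
    · obtain ⟨u, hu⟩ := hsurj fun p => if h : p ∈ S then y p.1 ⟨p.2, h⟩ else 0
      refine ⟨u, funext fun a => funext fun h => ?_⟩
      have := hu ⟨a, h.1⟩ h.2
      simp only [h.2, dite_true] at this
      exact this
  let e := LinearEquiv.ofBijective φ.toLinearMap hφ
  exact ⟨S, ⟨{ e with
    continuous_toFun := φ.continuous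
    continuous_invFun :=
      (Continuous.homeoOfEquivCompactToT2 (f := e.toEquiv) φ.continuous).symm.continuous }⟩⟩

/-! ### Indecomposable modules and categorical limits -/

theorem CategoryTheory.Indecomposable.eq_zero_or_eq_one_of_mul_self {A : Type*} [Ring A]
    {N : Type w} [AddCommGroup N] [Module A N] (hN : Indecomposable (ModuleCat.of A N))
    (e : Module.End A N) (he : e * e = e) : e = 0 ∨ e = 1 := by
  have hc : IsCompl (LinearMap.range e) (LinearMap.ker e) :=
    LinearMap.IsIdempotentElem.isCompl he
  let i : ModuleCat.of A N ≅ ModuleCat.of A (LinearMap.range e) ⊞ ModuleCat.of A (LinearMap.ker e) :=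
    (Submodule.prodEquivOfIsCompl _ _ hc).symm.toModuleIso ≪≫ 
      (ModuleCat.biprodIsoProd (.of A (LinearMap.range e)) (.of A (LinearMap.ker e))).symm
  rcases hN.2 _ _ i with h | h
  · left
    rwa [ModuleCat.isZero_of_iff_subsingleton, Submodule.subsingleton_iff_eq_bot,
      LinearMap.range_eq_bot] at h
  · right
    rw [ModuleCat.isZero_of_iff_subsingleton, Submodule.subsingleton_iff_eq_bot] at h
    ext x
    refine LinearMap.ker_eq_bot.1 h ?_
    exact LinearMap.congr_fun he x

theorem CategoryTheory.Indecomposable.nontrivial {A : Type*} [Ring A] {N : Type w} [AddCommGroup N]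
    [Module A N] (hN : Indecomposable (ModuleCat.of A N)) : Nontrivial N := by
  rw [← not_subsingleton_iff_nontrivial, ← ModuleCat.isZero_of_iff_subsingleton (R := A)]
  exact hN.1

namespace TopModuleCat

variable {A : Type u} [Ring A] [TopologicalSpace A]

/-- The projection from the point of a cone, as a continuous linear map. -/
abbrev coneProj {J : Type*} [Category* J] {F : J ⥤ TopModuleCat.{w} A} (c : Cone F) (j : J) :
    c.pt →L[A] F.obj j :=
  Hom.hom (X := c.pt) (c.π.app j)

/-- The compatible families with the subspace topology form a cone `s`. The lift from `s` is a
continuous left inverse of the comparison map, which is therefore an embedding. -/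
theorem isInverseLimit_of_isLimit {I : Type w} [PartialOrder I] {F : Iᵒᵖ ⥤ TopModuleCat.{w} A}
    {c : Cone F} (hc : IsLimit c) :
    IsInverseLimit (X := fun i => F.obj (op i)) (U := c.pt)
      (fun i j (h : i ≤ j) => ((F.map (homOfLE h).op).hom : F.obj (op j) →ₗ[A] F.obj (op i)))
      (fun i => (coneProj c (op i) : c.pt →ₗ[A] F.obj (op i))) := by
  let L : Submodule A (∀ i, F.obj (op i)) :=
    { carrier := {x | ∀ i j (h : i ≤ j), (F.map (homOfLE h).op).hom (x j) = x i}
      add_mem' := fun hx hy i j h => by simp [hx i j h, hy i j h]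
      zero_mem' := fun i j h => by simp
      smul_mem' := fun a x hx i j h => by simp [hx i j h] }
  let s : Cone F :=
    { pt := TopModuleCat.of A L
      π :=
        { app := fun i => TopModuleCat.ofHom (Y := F.obj i)
            ((ContinuousLinearMap.proj (φ := fun i => F.obj (op i)) i.unop).comp L.subtypeL)
          naturality := fun i j f => by
            ext x
            exact (x.2 j.unop i.unop (leOfHom f.unop)).symm } }
  have hproj (i j : I) (h : i ≤ j) (x : c.pt) :
      (F.map (homOfLE h).op).hom (coneProj c (op j) x) = coneProj c (op i) x :=
    congr($(c.w (homOfLE h).op).hom x)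
  let q : c.pt ⟶ s.pt := TopModuleCat.ofHom (X := c.pt) (Y := L)
    ((ContinuousLinearMap.pi fun i => coneProj c (op i)).codRestrict L fun x i j h =>
      hproj i j h x)
  have hq : q ≫ hc.lift s = 𝟙 c.pt := hc.hom_ext fun i => by
    rw [Category.assoc, hc.fac, Category.id_comp]
    rfl
  have hqe : IsEmbedding q.hom := Function.LeftInverse.isEmbedding (f := (hc.lift s).hom)
    (fun x => congr(($hq).hom x)) (hc.lift s).hom.continuous q.hom.continuous
  refine ⟨fun i x => ?_, fun i j k hij hjk x => ?_, hproj,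
    IsEmbedding.subtypeVal.comp hqe, fun x hx => ?_⟩
  · exact congr($(F.map_id (op i)).hom x)
  · exact congr($(F.map_comp (homOfLE hjk).op (homOfLE hij).op).hom x).symm
  · exact ⟨(hc.lift s).hom (⟨x, hx⟩ : L), fun i =>
      congr($(hc.fac s (op i)).hom (⟨x, hx⟩ : L))⟩

/-- The inverse system of the finite subproducts of a family of topological modules. -/
def finsetPiFunctor {T : Type w} (M : T → Type w) [∀ x, AddCommGroup (M x)] [∀ x, Module A (M x)]
    [∀ x, TopologicalSpace (M x)] [∀ x, ContinuousAdd (M x)] [∀ x, ContinuousSMul A (M x)] :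
    (Finset T)ᵒᵖ ⥤ TopModuleCat.{w} A where
  obj p := TopModuleCat.of A (∀ x : p.unop, M x)
  map {p q} f := TopModuleCat.ofHom (ContinuousLinearMap.pi fun x : q.unop =>
    ContinuousLinearMap.proj (φ := fun x : p.unop => M x) ⟨x, leOfHom f.unop x.2⟩)

/-- A product of topological modules is the limit of its finite subproducts. -/
def limitPresentationPi {T : Type w} (M : T → Type w) [∀ x, AddCommGroup (M x)]
    [∀ x, Module A (M x)] [∀ x, TopologicalSpace (M x)] [∀ x, ContinuousAdd (M x)]
    [∀ x, ContinuousSMul A (M x)] :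
    LimitPresentation (Finset T)ᵒᵖ (TopModuleCat.of A (∀ x, M x)) where
  diag := finsetPiFunctor M
  π :=
    { app := fun p => TopModuleCat.ofHom (ContinuousLinearMap.pi fun x : p.unop =>
        ContinuousLinearMap.proj (φ := M) x)
      naturality := fun p q f => rfl }
  isLimit :=
    { lift := fun s => TopModuleCat.ofHom (X := s.pt) (ContinuousLinearMap.pi fun x =>
        (ContinuousLinearMap.proj (φ := fun y : ({x} : Finset T) => M y)
          ⟨x, Finset.mem_singleton_self x⟩).comp (s.π.app (op {x})).hom)
      fac := fun s p => by
        ext u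
        funext x
        have h : ({x.1} : Finset T) ≤ p.unop := Finset.singleton_subset_iff.2 x.2
        exact congr_fun congr($(s.w (homOfLE h).op).hom u) ⟨x, Finset.mem_singleton_self _⟩ |>.symm
      uniq := fun s m hm => by
        ext u x
        exact congr_fun congr($(hm (op {x})).hom u) ⟨x, Finset.mem_singleton_self _⟩ }

end TopModuleCat

/-! ### Comparison of the two classes of modules -/

section

variable {A : Type u} [Ring A] {s : ℕ} {M : Fin s → Type w} [∀ i, AddCommGroup (M i)]
  [∀ i, Module A (M i)]

theorem isRetractOfSum_of_linearEquiv_pi {X : Type*} [AddCommGroup X] [Module A X] {n : ℕ}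
    {N : Fin n → Submodule A (∀ i, M i)} (hN : ∀ j, IsComplemented (N j))
    (e : X ≃ₗ[A] ∀ j, N j) : IsRetractOfSum A M X := by
  choose N' hN' using hN
  let q (j : Fin n) := (N j).projectionOnto (N' j) (hN' j)
  -- Each of the `n` summands is a retract of `∀ i, M i`, so the coordinates are indexed by pairs.
  let m : Fin (n * s) ≃ Fin n × Fin s := finProdFinEquiv.symm
  refine ⟨n * s, fun k => (m k).2,
    fun k => LinearMap.proj (m k).2 ∘ₗ (N (m k).1).subtype ∘ₗ LinearMap.proj (m k).1 ∘ₗ e.toLinearMap,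
    fun k => e.symm.toLinearMap ∘ₗ LinearMap.single A (fun j => N j) (m k).1 ∘ₗ q (m k).1 ∘ₗ
      LinearMap.single A M (m k).2, fun x => ?_⟩
  rw [m.sum_comp (fun k : Fin n × Fin s => (e.symm.toLinearMap ∘ₗ
    LinearMap.single A (fun j => N j) k.1 ∘ₗ q k.1 ∘ₗ LinearMap.single A M k.2)
    ((LinearMap.proj k.2 ∘ₗ (N k.1).subtype ∘ₗ LinearMap.proj k.1 ∘ₗ e.toLinearMap) x)),
    Fintype.sum_prod_type]
  have h (j : Fin n) : ∑ i, LinearMap.single A M i ((e x j : ∀ i, M i) i) = e x j :=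
    Finset.univ_sum_single _
  simp only [LinearMap.comp_apply, ← map_sum, LinearMap.proj_apply, Submodule.subtype_apply,
    LinearEquiv.coe_coe, h, q, Submodule.projectionOnto_apply_left]
  rw [LinearEquiv.symm_apply_eq]
  exact Finset.univ_sum_single _

theorem isComplemented_range_single (i : Fin s) :
    IsComplemented (LinearMap.range (LinearMap.single A M i)) :=
  ⟨_, LinearMap.isCompl_of_proj (f := (LinearMap.single A M i).rangeRestrict ∘ₗ LinearMap.proj i) <| by
    rintro ⟨_, x, rfl⟩
    ext : 1
    simp⟩

theorem smallAdd_pi [TopologicalSpace A] [IsTopologicalRing A] [∀ i, TopologicalSpace (M i)]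
    [∀ i, IsModuleTopology A (M i)] [∀ i, ContinuousAdd (M i)] {T : Type w} [Finite T]
    (f : T → Fin s) : smallAdd M (TopModuleCat.of A (∀ x, M (f x))) := by
  obtain ⟨n, ⟨m⟩⟩ := Finite.exists_equiv_fin T
  refine ⟨inferInstanceAs (IsModuleTopology A (∀ x, M (f x))), n,
    fun j => LinearMap.range (LinearMap.single A M (f (m.symm j))),
    fun j => isComplemented_range_single _, ⟨?_⟩⟩
  exact (LinearEquiv.piCongrLeft' A (fun x => M (f x)) m).trans (LinearEquiv.piCongrRight fun j =>
    LinearEquiv.ofInjective _ (Pi.single_injective (f (m.symm j))))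

theorem bigAdd_le_limAdd [TopologicalSpace A] [IsTopologicalRing A] [∀ i, TopologicalSpace (M i)]
    [∀ i, IsModuleTopology A (M i)] : bigAdd (A := A) M ≤ limAdd (A := A) M := by
  classical
  rintro U ⟨κ, ⟨e⟩⟩
  have (i : Fin s) : ContinuousAdd (M i) := IsModuleTopology.toContinuousAdd A (M i)
  let P := TopModuleCat.limitPresentationPi (A := A) fun x : Σ i, κ i => M x.1
  let e' : (∀ x : Σ i, κ i, M x.1) ≃L[A] U :=
    ContinuousLinearEquiv.trans
      { (Equiv.piCurry fun (i : Fin s) (_ : κ i) => M i) with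
        map_add' := fun _ _ => rfl
        map_smul' := fun _ _ => rfl
        continuous_toFun := continuous_pi fun i => continuous_pi fun k => continuous_apply _
        continuous_invFun := continuous_pi fun x =>
          (continuous_apply x.2).comp (continuous_apply x.1) } e.symm
  refine ⟨Finset (Σ i, κ i), inferInstance, ⟨fun a b => ⟨a ∪ b, Finset.subset_union_left,
    Finset.subset_union_right⟩⟩, ⟨∅⟩, ⟨LimitPresentation.ofIso P (TopModuleCat.ofIso
      (X := TopModuleCat.of A (∀ x : Σ i, κ i, M x.1)) e'), fun p => ?_⟩⟩
  exact smallAdd_pi fun x : p.unop => x.1.1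

theorem limAdd_le_bigAdd (R : Type*) [CommRing R] [TopologicalSpace R] [IsTopologicalRing R]
    [CompactSpace R] [T2Space R] [IsLocalRing R] [IsNoetherianRing R] [Algebra R A]
    [Module.Finite R A] [TopologicalSpace A] [IsTopologicalRing A] [CompactSpace A] [T2Space A]
    [∀ i, TopologicalSpace (M i)] [∀ i, IsModuleTopology A (M i)] [∀ i, Module.Finite A (M i)]
    (hM : ∀ i, Indecomposable (ModuleCat.of A (M i))) :
    limAdd (A := A) M ≤ bigAdd (A := A) M := by
  rintro U ⟨I, _, _, _, ⟨P⟩⟩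
  have (i : Fin s) := (hM i).nontrivial
  have (i : I) : IsModuleTopology A (P.diag.obj (op i)) := (P.prop_diag_obj (op i)).1
  have hX (i : I) := (P.prop_diag_obj (op i)).2
  have : IsNoetherianRing A :=
    isNoetherian_of_tower R (isNoetherian_of_isNoetherianRing_of_finite R A)
  have (i : I) : Module.Finite A (P.diag.obj (op i)) := by
    obtain ⟨n, N, hN, ⟨e⟩⟩ := hX i
    exact Module.Finite.equiv e.symm
  obtain ⟨S, ⟨e⟩⟩ := exists_continuousLinearEquiv_pi_of_isInverseLimit (A := A) R (M := M)
    (fun i => (hM i).eq_zero_or_eq_one_of_mul_self) (fun i => by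
      obtain ⟨n, N, hN, ⟨e⟩⟩ := hX i
      exact isRetractOfSum_of_linearEquiv_pi hN e)
    (TopModuleCat.isInverseLimit_of_isLimit P.isLimit) fun i => (P.π.app (op i)).hom.continuous
  exact ⟨_, ⟨e⟩⟩

end

namespace MonoidAlgebra

variable (R : Type u) (G : Type v) [TopologicalSpace R]

theorem isClosedEmbedding_coeff [Semiring R] [Finite G] :
    IsClosedEmbedding fun (x : MonoidAlgebra R G) (g : G) => x.coeff g := by
  refine ⟨⟨⟨rfl⟩, fun x y h => ?_⟩, ?_⟩
  · ext g
    exact congr_fun h g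
  · convert isClosed_univ
    refine Set.eq_univ_of_forall fun f => ⟨.ofCoeff (Finsupp.equivFunOnFinite.symm f), ?_⟩
    funext g
    simp

end MonoidAlgebra

theorem theorem2p2
    (R : Type u) [CommRing R] [TopologicalSpace R] [IsTopologicalRing R]
    [CompactSpace R] [T2Space R] [TotallyDisconnectedSpace R]
    [IsLocalRing R] [IsNoetherianRing R]
    (G : Type v) [Group G] [Finite G]
    (s : ℕ) (M : Fin s → Type w)
    [∀ i, AddCommGroup (M i)] [∀ i, Module (MonoidAlgebra R G) (M i)]
    [∀ i, Module.Finite (MonoidAlgebra R G) (M i)]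
    [∀ i, TopologicalSpace (M i)] [∀ i, IsModuleTopology (MonoidAlgebra R G) (M i)]
    (hindec : ∀ i, Indecomposable (ModuleCat.of (MonoidAlgebra R G) (M i)))
    (hnoniso : Pairwise fun i j => IsEmpty (M i ≃ₗ[MonoidAlgebra R G] M j)) :
    (∀ U : TopModuleCat.{w} (MonoidAlgebra R G),
      limAdd (A := MonoidAlgebra R G) M U → bigAdd (A := MonoidAlgebra R G) M U) ∧
    ∃ h : bigAdd (A := MonoidAlgebra R G) M ≤ limAdd (A := MonoidAlgebra R G) M,
      (ObjectProperty.ιOfLE h).IsEquivalence := by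
  have := (MonoidAlgebra.isClosedEmbedding_coeff R G).compactSpace
  have := (MonoidAlgebra.isClosedEmbedding_coeff R G).isEmbedding.t2Space
  have hle : limAdd (A := MonoidAlgebra R G) M ≤ bigAdd (A := MonoidAlgebra R G) M :=
    limAdd_le_bigAdd R hindec
  refine ⟨fun U hU => hle U hU, bigAdd_le_limAdd, ?_⟩
  -- Both categories are full subcategories, so only essential surjectivity is at stake.
  have : (ObjectProperty.ιOfLE (bigAdd_le_limAdd (A := MonoidAlgebra R G) (M := M))).EssSurj :=
    ⟨fun U => ⟨⟨U.1, hle _ U.2⟩, ⟨Iso.refl _⟩⟩⟩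
  exact {}
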